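/- Let $n,t\in\mathbb N$ and let $\mathbb R[\bar X]=\mathbb R[X_1,\dots,X_n]$. Let $\mathbb R[\bar X]^{t\times t}$ be the ring of real $t\times t$ matrix polynomials, with involution $p\mapsto p^*$ given by the transpose, and let $\operatorname{Sym}\mathbb R[\bar X]^{t\times t}=\{p\in\mathbb R[\bar X]^{t\times t}\mid p=p^*\}$. For $G\subseteq\operatorname{Sym}\mathbb R[\bar X]^{t\times t}$ put $$S_G=\{x\in\mathbb R^n\mid g(x)\text{ is positive semidefinite for all }g\in G\},$$ $$M_G=\Big\{\sum_{i=1}^N p_i^*g_ip_i \;\Big|\; N\in\mathbb N,\ g_i\in\{1\}\cup G,\ p_i\in\mathbb R[\bar X]^{t\times t}\Big\}.$$ Suppose that $M_G$ is archimedean, i.e. for every $a\in\mathbb R[\bar X]^{t\times t}$ there is $N\in\mathbb N$ with $N-a^*a\in M_G$. A state on $(\operatorname{Sym}\mathbb R[\bar X]^{t\times t},M_G)$ is an $\mathbb R$-linear form $L:\operatorname{Sym}\mathbb R[\bar X]^{t\times t}\to\mathbb R$ with $L(M_G)\subseteq\mathbb R_{\ge 0}$ and $L(1)=1$; it is pure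 if it is an extreme point of the convex set of all states. Then for each pure state $L$ on $(\operatorname{Sym}\mathbb R[\bar X]^{t\times t},M_G)$ there exist $x\in S_G$ and a unit vector $v\in\mathbb R^t$ (for the Euclidean norm) such that $$L(p)=\langle p(x)v,v\rangle\qquad\text{for all }p\in\operatorname{Sym}\mathbb R[\bar X]^{t\times t}.$$ -/

import Mathlib

/-- The ring of real `t × t` matrix polynomials in `n` variables. Its involution is the
transpose. -/
abbrev MatPoly (n t : ℕ) : Type := Matrix (Fin t) (Fin t) (MvPolynomial (Fin n) ℝ)

/-- The real vector space of symmetric matrix polynomials. -/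
def symMatPoly (n t : ℕ) : Submodule ℝ (MatPoly n t) where
  carrier := {p | p.transpose = p}
  zero_mem' := Matrix.transpose_zero
  add_mem' := by
    intro p q hp hq
    change (p + q).transpose = p + q
    rw [Matrix.transpose_add, show p.transpose = p from hp, show q.transpose = q from hq]
  smul_mem' := by
    intro c p hp
    change (c • p).transpose = c • p
    rw [Matrix.transpose_smul, show p.transpose = p from hp]

theorem one_mem_symMatPoly (n t : ℕ) : (1 : MatPoly n t) ∈ symMatPoly n t :=
  Matrix.transpose_one

/-- The real matrix `p(x)`. -/
noncomputable def evalMatPoly {n t : ℕ} (x : Fin n → ℝ) (p : MatPoly n t) :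
    Matrix (Fin t) (Fin t) ℝ :=
  p.map (MvPolynomial.eval x)

/-- The set `S_G` of all points at which every element of `G` is positive semidefinite. -/
def positivitySet {n t : ℕ} (G : Set (MatPoly n t)) : Set (Fin n → ℝ) :=
  {x | ∀ g ∈ G, (evalMatPoly x g).PosSemidef}

/-- The quadratic module `M_G` generated by `G`: all finite sums `∑ pᵢ* gᵢ pᵢ`
with `gᵢ ∈ {1} ∪ G`. -/
def quadraticModule {n t : ℕ} (G : Set (MatPoly n t)) : Set (MatPoly n t) :=
  {f | ∃ (N : ℕ) (g p : Fin N → MatPoly n t),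
    (∀ i, g i ∈ ({1} ∪ G : Set (MatPoly n t))) ∧
    f = ∑ i, (p i).transpose * g i * p i}

/-- `M` is archimedean: for every matrix polynomial `a` (symmetric or not) there is a natural
number `N` with `N - a* a ∈ M`. -/
def IsArchimedeanModule {n t : ℕ} (M : Set (MatPoly n t)) : Prop :=
  ∀ a : MatPoly n t, ∃ N : ℕ, (N : MatPoly n t) - a.transpose * a ∈ M

/-- The set of states on `(symMatPoly n t, M)`: real linear forms on the symmetric matrix
polynomials that are nonnegative on `M` and take the value `1` at the identity. -/
def stateSet {n t : ℕ} (M : Set (MatPoly n t)) : Set (symMatPoly n t →ₗ[ℝ] ℝ) :=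
  {L | (∀ f : symMatPoly n t, (f : MatPoly n t) ∈ M → 0 ≤ L f) ∧
    L ⟨1, one_mem_symMatPoly n t⟩ = 1}

/-- A pure state is an extreme point of the convex set of all states. -/
def IsPureState {n t : ℕ} (M : Set (MatPoly n t)) (L : symMatPoly n t →ₗ[ℝ] ℝ) : Prop :=
  L ∈ (stateSet M).extremePoints ℝ

/-!
A pure state `L` is shown to be a vector state at one point in two steps, each resting on the fact
that a positive form dominated by a pure state is a multiple of it
(`IsPureState.eq_smul_of_le`; the archimedean property makes the identity an order unit, which
settles the degenerate cases of the convex combination).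

The centre. For a scalar polynomial `h` the form `p ↦ L (h² p)` is positive on the quadratic module
and dominated by a multiple `N L`. For the domination, fix `p` in the module: the sequence
`L (h²ᵏ p)` is log-convex by Cauchy–Schwarz and is bounded by a constant times `Nᵏ` when
`N - h²` lies in the module, so its first ratio is at most `N` (`NonnegOn.sub_twist_sq`). By
purity `L (h² p) = L (h²) L p`, and polarisation gives `L (f p) = L (f) L p` for every scalar `f`.
On scalar polynomials `L` is therefore evaluation at a point `x` (`IsPureState.exists_point`).

The fibre. Hence `L p = tr (p(x) ρ)` for a symmetric real matrix `ρ` of trace one. Evaluating `L` on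
`qᵀ g q` with `q` of rank one shows that `ρ` and all `g(x)` are positive semidefinite. If
`ρ i i > 0` and `w` is the `i`-th column of `ρ`, then `ρ - (ρ i i)⁻¹ w wᵀ` is positive semidefinite,
so the form `p ↦ (ρ i i)⁻¹ wᵀ p(x) w` is dominated by `L`, and by purity it is a multiple of `L`.
Normalising `w` gives the required unit vector.
-/

/-! ### Scalar polynomials acting on symmetric matrix polynomials -/

/-- Multiplication of a symmetric matrix polynomial by a scalar polynomial. -/
noncomputable instance symMatPolyModule (n t : ℕ) :
    Module (MvPolynomial (Fin n) ℝ) (symMatPoly n t) where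
  smul f p := ⟨f • (p : MatPoly n t), by
    change (f • (p : MatPoly n t)).transpose = f • (p : MatPoly n t)
    rw [Matrix.transpose_smul, show (p : MatPoly n t).transpose = p from p.2]⟩
  one_smul p := Subtype.ext (one_smul _ (p : MatPoly n t))
  mul_smul f g p := Subtype.ext (mul_smul f g (p : MatPoly n t))
  smul_zero f := Subtype.ext (smul_zero f)
  smul_add f p q := Subtype.ext (smul_add f (p : MatPoly n t) q)
  add_smul f g p := Subtype.ext (add_smul f g (p : MatPoly n t))
  zero_smul p := Subtype.ext (zero_smul _ (p : MatPoly n t))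

theorem coe_polySMul {n t : ℕ} (f : MvPolynomial (Fin n) ℝ) (p : symMatPoly n t) :
    ((f • p : symMatPoly n t) : MatPoly n t) = f • (p : MatPoly n t) := rfl

instance symMatPoly_isScalarTower (n t : ℕ) :
    IsScalarTower ℝ (MvPolynomial (Fin n) ℝ) (symMatPoly n t) where
  smul_assoc c f p := Subtype.ext (smul_assoc c f (p : MatPoly n t))

instance symMatPoly_smulCommClass (n t : ℕ) :
    SMulCommClass ℝ (MvPolynomial (Fin n) ℝ) (symMatPoly n t) where
  smul_comm c f p := Subtype.ext (smul_comm c f (p : MatPoly n t))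

/-- The identity matrix, as a symmetric matrix polynomial. -/
noncomputable def symOne (n t : ℕ) : symMatPoly n t := ⟨1, one_mem_symMatPoly n t⟩

/-- The linear form `p ↦ L (f p)` for a scalar polynomial `f`. -/
noncomputable def twist {n t : ℕ} (f : MvPolynomial (Fin n) ℝ) (L : symMatPoly n t →ₗ[ℝ] ℝ) :
    symMatPoly n t →ₗ[ℝ] ℝ where
  toFun p := L (f • p)
  map_add' p q := by rw [smul_add, map_add]
  map_smul' c p := by rw [smul_comm, map_smul, RingHom.id_apply]

/-- The linear form `L` is nonnegative on the symmetric elements of `M`. -/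
def NonnegOn {n t : ℕ} (M : Set (MatPoly n t)) (L : symMatPoly n t →ₗ[ℝ] ℝ) : Prop :=
  ∀ f : symMatPoly n t, (f : MatPoly n t) ∈ M → 0 ≤ L f

/-! ### Quadratic modules -/

section QuadraticModule

variable {n t : ℕ} {G : Set (MatPoly n t)}

theorem conj_mem_quadraticModule {g : MatPoly n t} (hg : g ∈ ({1} ∪ G : Set (MatPoly n t)))
    (q : MatPoly n t) : q.transpose * g * q ∈ quadraticModule G :=
  ⟨1, fun _ => g, fun _ => q, fun _ => hg, by simp⟩

theorem quadraticModule_add {a b : MatPoly n t} (ha : a ∈ quadraticModule G)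
    (hb : b ∈ quadraticModule G) : a + b ∈ quadraticModule G := by
  obtain ⟨N, g, p, hg, rfl⟩ := ha
  obtain ⟨N', g', p', hg', rfl⟩ := hb
  refine ⟨N + N', Fin.append g g', Fin.append p p', fun i => ?_, ?_⟩
  · refine Fin.addCases (fun i => ?_) (fun i => ?_) i
    · simpa using hg i
    · simpa using hg' i
  · simp [Fin.sum_univ_add]

theorem quadraticModule_conj {a : MatPoly n t} (ha : a ∈ quadraticModule G) (q : MatPoly n t) :
    q.transpose * a * q ∈ quadraticModule G := by
  obtain ⟨N, g, p, hg, rfl⟩ := ha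
  refine ⟨N, g, fun i => p i * q, hg, ?_⟩
  rw [Matrix.mul_sum, Matrix.sum_mul]
  simp only [Matrix.transpose_mul, Matrix.mul_assoc]

theorem quadraticModule_sq_smul {a : MatPoly n t} (ha : a ∈ quadraticModule G)
    (f : MvPolynomial (Fin n) ℝ) : (f * f) • a ∈ quadraticModule G := by
  have h := quadraticModule_conj ha (f • (1 : MatPoly n t))
  simpa [Matrix.transpose_smul, smul_smul] using h

theorem quadraticModule_smul {a : MatPoly n t} (ha : a ∈ quadraticModule G) {c : ℝ} (hc : 0 ≤ c) :
    c • a ∈ quadraticModule G := by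
  have h := quadraticModule_sq_smul ha (MvPolynomial.C (Real.sqrt c))
  rw [← map_mul, Real.mul_self_sqrt hc] at h
  rwa [← algebraMap_smul (MvPolynomial (Fin n) ℝ) c a, MvPolynomial.algebraMap_eq]

/-- In an archimedean quadratic module the identity is an order unit. -/
theorem exists_smul_one_sub_mem (hM : IsArchimedeanModule (quadraticModule G))
    (p : symMatPoly n t) :
    ∃ c : ℝ, 0 ≤ c ∧ ((c • symOne n t - p : symMatPoly n t) : MatPoly n t) ∈ quadraticModule G := by
  obtain ⟨N, hN⟩ := hM p
  have hp : (p : MatPoly n t).transpose = p := p.2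
  -- `(N + 1) / 2 - p = ((N - p²) + (1 - p)²) / 2`
  refine ⟨(N + 1) / 2, by positivity, ?_⟩
  have h1 := conj_mem_quadraticModule (G := G) (Or.inl rfl) (1 - (p : MatPoly n t))
  have h := quadraticModule_smul (quadraticModule_add hN h1) (c := 1 / 2) (by norm_num)
  convert h using 1
  have hNat : (N : MatPoly n t) = (N : ℝ) • (1 : MatPoly n t) := by
    rw [Nat.cast_smul_eq_nsmul, nsmul_one]
  change ((N + 1 : ℝ) / 2) • (1 : MatPoly n t) - (p : MatPoly n t) = _
  rw [Matrix.transpose_sub, Matrix.transpose_one, hp, hNat]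
  generalize (p : MatPoly n t) = P
  have : (1 - P) * 1 * (1 - P) = 1 - P - P + P * P := by noncomm_ring
  rw [this]
  module

end QuadraticModule

/-! ### Positive forms and purity -/

section Functionals

variable {n t : ℕ} {G : Set (MatPoly n t)}

theorem twist_add (f g : MvPolynomial (Fin n) ℝ) (L : symMatPoly n t →ₗ[ℝ] ℝ) :
    twist (f + g) L = twist f L + twist g L :=
  LinearMap.ext fun p => by
    change L ((f + g) • p) = L (f • p) + L (g • p)
    rw [add_smul, map_add]

theorem twist_smul (c : ℝ) (f : MvPolynomial (Fin n) ℝ) (L : symMatPoly n t →ₗ[ℝ] ℝ) :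
    twist (c • f) L = c • twist f L :=
  LinearMap.ext fun p => by
    change L ((c • f) • p) = c • L (f • p)
    rw [smul_assoc, map_smul]

theorem NonnegOn.twist_sq {L : symMatPoly n t →ₗ[ℝ] ℝ} (hL : NonnegOn (quadraticModule G) L)
    (f : MvPolynomial (Fin n) ℝ) : NonnegOn (quadraticModule G) (twist (f * f) L) :=
  fun p hp => hL ((f * f) • p) (quadraticModule_sq_smul hp f)

theorem NonnegOn.one_nonneg {L : symMatPoly n t →ₗ[ℝ] ℝ} (hL : NonnegOn (quadraticModule G) L) :
    0 ≤ L (symOne n t) := by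
  refine hL _ ?_
  have h := conj_mem_quadraticModule (G := G) (Or.inl rfl) (1 : MatPoly n t)
  rwa [Matrix.transpose_one, mul_one, mul_one] at h

/-- A positive form vanishing at the order unit vanishes. -/
theorem NonnegOn.eq_zero {L : symMatPoly n t →ₗ[ℝ] ℝ} (hL : NonnegOn (quadraticModule G) L)
    (hM : IsArchimedeanModule (quadraticModule G)) (h1 : L (symOne n t) = 0) : L = 0 := by
  have key : ∀ p, L p ≤ 0 := fun p => by
    obtain ⟨c, -, hc⟩ := exists_smul_one_sub_mem hM p
    have := hL _ hc
    rw [map_sub, map_smul, h1, smul_zero] at this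
    linarith
  refine LinearMap.ext fun p => ?_
  have := key (-p)
  rw [map_neg] at this
  exact le_antisymm (key p) (neg_nonpos.1 this)

/-- A positive form dominated by a pure state is a multiple of it. -/
theorem IsPureState.eq_smul_of_le {L K : symMatPoly n t →ₗ[ℝ] ℝ}
    (hL : IsPureState (quadraticModule G) L) (hM : IsArchimedeanModule (quadraticModule G))
    (hK : NonnegOn (quadraticModule G) K) (hLK : NonnegOn (quadraticModule G) (L - K)) :
    K = K (symOne n t) • L := by
  have hL1 : L (symOne n t) = 1 := hL.1.2
  set c := K (symOne n t) with hc
  have hc0 : 0 ≤ c := hK.one_nonneg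
  have hc1 : 0 ≤ 1 - c := by
    have := hLK.one_nonneg
    rwa [LinearMap.sub_apply, hL1] at this
  rcases hc0.eq_or_lt with h0 | h0
  · rw [← h0, zero_smul]
    exact hK.eq_zero hM h0.symm
  rcases hc1.eq_or_lt with h1 | h1
  · have h := hLK.eq_zero hM (by rw [LinearMap.sub_apply, hL1, ← hc, ← h1])
    rw [show c = 1 by linarith, one_smul]
    exact (sub_eq_zero.mp h).symm
  have m1 : c⁻¹ • K ∈ stateSet (quadraticModule G) :=
    ⟨fun f hf => mul_nonneg (inv_nonneg.2 hc0) (hK f hf), inv_mul_cancel₀ h0.ne'⟩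
  have m2 : (1 - c)⁻¹ • (L - K) ∈ stateSet (quadraticModule G) := by
    refine ⟨fun f hf => mul_nonneg (inv_nonneg.2 hc1) (hLK f hf), ?_⟩
    change (1 - c)⁻¹ * (L (symOne n t) - K (symOne n t)) = 1
    rw [hL1, ← hc, inv_mul_cancel₀ h1.ne']
  have hseg : L ∈ openSegment ℝ (c⁻¹ • K) ((1 - c)⁻¹ • (L - K)) := by
    refine ⟨c, 1 - c, h0, h1, by ring, ?_⟩
    rw [smul_inv_smul₀ h0.ne', smul_inv_smul₀ h1.ne', add_sub_cancel]
  have h := (mem_extremePoints.1 hL).2 _ m1 _ m2 hseg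
  rw [← h.1, smul_inv_smul₀ h0.ne']

end Functionals

/-! ### Multiplicativity over the centre -/

/-- A nonnegative log-convex sequence bounded by a geometric one of ratio `N` has its first
ratio at most `N`: the ratios of consecutive terms increase. -/
theorem le_mul_of_logConvex {a : ℕ → ℝ} {C N : ℝ} (hN : 0 < N) (ha : ∀ k, 0 ≤ a k)
    (hlc : ∀ k, a (k + 1) ^ 2 ≤ a k * a (k + 2)) (hb : ∀ k, a k ≤ C * N ^ k) :
    a 1 ≤ N * a 0 := by
  by_contra! hlt
  have h0 : 0 < a 0 := by
    rcases (ha 0).eq_or_lt with h | h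
    · have := hlc 0
      rw [← h] at this hlt
      nlinarith
    · exact h
  set r := a 1 / a 0 with hr
  have hrN : N < r := by rw [hr, lt_div_iff₀ h0]; exact hlt
  have hr0 : 0 < r := hN.trans hrN
  have step : ∀ k, 0 < a k ∧ r * a k ≤ a (k + 1) := by
    intro k
    induction k with
    | zero => exact ⟨h0, by rw [hr, div_mul_cancel₀ _ h0.ne']⟩
    | succ k ih =>
      have hpos : 0 < a (k + 1) := lt_of_lt_of_le (mul_pos hr0 ih.1) ih.2
      refine ⟨hpos, ?_⟩
      have h1 : a k * (r * a (k + 1)) ≤ a k * a (k + 2) := by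
        have := mul_le_mul_of_nonneg_right ih.2 hpos.le
        have := hlc k
        nlinarith
      exact le_of_mul_le_mul_left h1 ih.1
  have hgeo : ∀ k, a 0 * r ^ k ≤ a k := by
    intro k
    induction k with
    | zero => simp
    | succ k ih =>
      have := mul_le_mul_of_nonneg_left ih hr0.le
      rw [pow_succ]
      linarith [(step k).2]
  obtain ⟨k, hk⟩ := pow_unbounded_of_one_lt (C / a 0) ((one_lt_div hN).2 hrN)
  have h1 := (hgeo k).trans (hb k)
  rw [div_pow, div_lt_div_iff₀ h0 (by positivity)] at hk
  linarith

section PureStates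

variable {n t : ℕ} {G : Set (MatPoly n t)}

/-- If `N - h²` lies in the quadratic module, then multiplication by `N - h²` preserves
positivity of forms. -/
theorem NonnegOn.sub_twist_sq {L : symMatPoly n t →ₗ[ℝ] ℝ} (hL : NonnegOn (quadraticModule G) L)
    (hM : IsArchimedeanModule (quadraticModule G)) {h : MvPolynomial (Fin n) ℝ} {N : ℝ}
    (hN : 0 < N)
    (hh : ((N • symOne n t - (h * h) • symOne n t : symMatPoly n t) : MatPoly n t) ∈
      quadraticModule G) :
    NonnegOn (quadraticModule G) (N • L - twist (h * h) L) := by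
  intro p hp
  obtain ⟨C, hC0, hC⟩ := exists_smul_one_sub_mem hM p
  have hone : ∀ k : ℕ, L ((h ^ k * h ^ k) • symOne n t) ≤ L (symOne n t) * N ^ k := by
    intro k
    induction k with
    | zero => simp
    | succ k ih =>
      have h1 := (hL.twist_sq (h ^ k)) _ hh
      have h2 : twist (h ^ k * h ^ k) L (N • symOne n t - (h * h) • symOne n t) =
          N * L ((h ^ k * h ^ k) • symOne n t) -
            L ((h ^ (k + 1) * h ^ (k + 1)) • symOne n t) := by
        rw [map_sub, map_smul]
        change N * L _ - L _ = _
        rw [smul_smul]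
        congr 3
        ring
      have h3 := mul_le_mul_of_nonneg_left ih hN.le
      rw [pow_succ N]
      linarith
  have key := le_mul_of_logConvex (a := fun k => L ((h ^ k * h ^ k) • p))
    (C := C * L (symOne n t)) hN (fun k => hL.twist_sq (h ^ k) p hp) ?_ ?_
  · change 0 ≤ N * L p - L ((h * h) • p)
    simp only [pow_one, pow_zero, one_mul, one_smul] at key
    linarith
  · intro k
    -- the quadratic polynomial `r ↦ L ((r h² + 1)² h²ᵏ p)` is nonnegative
    have hq : ∀ r : ℝ, 0 ≤ L ((h ^ (k + 2) * h ^ (k + 2)) • p) * (r * r) +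
        2 * L ((h ^ (k + 1) * h ^ (k + 1)) • p) * r + L ((h ^ k * h ^ k) • p) := by
      intro r
      have h1 := hL.twist_sq (h ^ k * (MvPolynomial.C r * (h * h) + 1)) p hp
      have e : (h ^ k * (MvPolynomial.C r * (h * h) + 1)) *
          (h ^ k * (MvPolynomial.C r * (h * h) + 1)) =
          (r * r) • (h ^ (k + 2) * h ^ (k + 2)) + (2 * r) • (h ^ (k + 1) * h ^ (k + 1)) +
            h ^ k * h ^ k := by
        simp only [MvPolynomial.smul_eq_C_mul, map_mul, map_ofNat]
        ring
      rw [e, twist_add, twist_add, twist_smul, twist_smul] at h1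
      change 0 ≤ (r * r) * L _ + (2 * r) * L _ + L _ at h1
      linarith
    have hd := discrim_le_zero hq
    rw [discrim] at hd
    change L ((h ^ (k + 1) * h ^ (k + 1)) • p) ^ 2 ≤
      L ((h ^ k * h ^ k) • p) * L ((h ^ (k + 2) * h ^ (k + 2)) • p)
    linarith
  · intro k
    have h1 := hL.twist_sq (h ^ k) _ hC
    rw [map_sub, map_smul] at h1
    change 0 ≤ C * L _ - L _ at h1
    have h2 := mul_le_mul_of_nonneg_left (hone k) hC0
    change L _ ≤ _
    linarith

/-- A pure state is multiplicative on squares of scalar polynomials. -/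
theorem IsPureState.twist_sq {L : symMatPoly n t →ₗ[ℝ] ℝ}
    (hL : IsPureState (quadraticModule G) L) (hM : IsArchimedeanModule (quadraticModule G))
    (h : MvPolynomial (Fin n) ℝ) :
    twist (h * h) L = L ((h * h) • symOne n t) • L := by
  have hpos : NonnegOn (quadraticModule G) L := hL.1.1
  obtain ⟨c, hc0, hc⟩ := exists_smul_one_sub_mem hM ((h * h) • symOne n t)
  have hN : 0 < c + 1 := by linarith
  have hc' : (((c + 1) • symOne n t - (h * h) • symOne n t : symMatPoly n t) : MatPoly n t) ∈
      quadraticModule G := by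
    have h1 := quadraticModule_add hc
      (conj_mem_quadraticModule (G := G) (Or.inl rfl) (1 : MatPoly n t))
    convert h1 using 1
    change (c + 1) • (1 : MatPoly n t) - (h * h) • (1 : MatPoly n t) =
      c • (1 : MatPoly n t) - (h * h) • (1 : MatPoly n t) + _
    rw [Matrix.transpose_one, mul_one, mul_one, add_smul, one_smul]
    abel
  have h2 := hpos.sub_twist_sq hM hN hc'
  have h3 := hL.eq_smul_of_le hM (K := (c + 1)⁻¹ • twist (h * h) L)
    (fun f hf => mul_nonneg (inv_nonneg.2 hN.le) (hpos.twist_sq h f hf))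
    (fun f hf => by
      have h4 := mul_nonneg (inv_nonneg.2 hN.le) (h2 f hf)
      change 0 ≤ (c + 1)⁻¹ * ((c + 1) * L f - twist (h * h) L f) at h4
      change 0 ≤ L f - (c + 1)⁻¹ * twist (h * h) L f
      rwa [mul_sub, inv_mul_cancel_left₀ hN.ne'] at h4)
  have h5 := congrArg (fun K => (c + 1) • K) h3
  change (c + 1) • ((c + 1)⁻¹ • twist (h * h) L) =
    (c + 1) • (((c + 1)⁻¹ * L ((h * h) • symOne n t)) • L) at h5
  rwa [smul_inv_smul₀ hN.ne', smul_smul, mul_inv_cancel_left₀ hN.ne'] at h5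

/-- A pure state is multiplicative over the centre, the ring of scalar polynomials. -/
theorem IsPureState.map_polySMul {L : symMatPoly n t →ₗ[ℝ] ℝ}
    (hL : IsPureState (quadraticModule G) L) (hM : IsArchimedeanModule (quadraticModule G))
    (f : MvPolynomial (Fin n) ℝ) (p : symMatPoly n t) :
    L (f • p) = L (f • symOne n t) * L p := by
  -- `4 f = (f + 1)² - (f - 1)²`
  have e : ∀ q : symMatPoly n t,
      4 * L (f • q) = L (((f + 1) * (f + 1)) • q) - L (((f - 1) * (f - 1)) • q) := by
    intro q
    have : (4 : ℝ) • (f • q) = ((f + 1) * (f + 1)) • q - ((f - 1) * (f - 1)) • q := by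
      rw [← sub_smul, ← smul_assoc]
      congr 1
      rw [MvPolynomial.smul_eq_C_mul, map_ofNat]
      ring
    rw [← map_sub, ← this, map_smul L (4 : ℝ), smul_eq_mul]
  have h1 := LinearMap.congr_fun (hL.twist_sq hM (f + 1)) p
  have h2 := LinearMap.congr_fun (hL.twist_sq hM (f - 1)) p
  change L _ = L _ * L p at h1 h2
  have e1 := e (symOne n t)
  have e2 := e p
  rw [h1, h2, ← sub_mul, ← e1] at e2
  linarith

/-- On scalar polynomials a pure state is evaluation at a point `x`, and scalars pull out of it
as their values at `x`. -/
theorem IsPureState.exists_point {L : symMatPoly n t →ₗ[ℝ] ℝ}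
    (hL : IsPureState (quadraticModule G) L) (hM : IsArchimedeanModule (quadraticModule G)) :
    ∃ x : Fin n → ℝ, ∀ (f : MvPolynomial (Fin n) ℝ) (p : symMatPoly n t),
      L (f • p) = MvPolynomial.eval x f * L p := by
  have hmul := hL.map_polySMul hM
  let φ : MvPolynomial (Fin n) ℝ →ₐ[ℝ] ℝ := AlgHom.ofLinearMap
    { toFun := fun f => L (f • symOne n t)
      map_add' := fun f g => by rw [add_smul, map_add]
      map_smul' := fun c f => by rw [smul_assoc, map_smul, RingHom.id_apply] }
    (by
      change L ((1 : MvPolynomial (Fin n) ℝ) • symOne n t) = 1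
      rw [one_smul]
      exact hL.1.2)
    (fun f g => by
      change L ((f * g) • symOne n t) = L (f • symOne n t) * L (g • symOne n t)
      rw [mul_smul, hmul])
  refine ⟨fun i => φ (MvPolynomial.X i), fun f p => ?_⟩
  have h : φ f = MvPolynomial.eval (fun i => φ (MvPolynomial.X i)) f := by
    conv_lhs => rw [MvPolynomial.aeval_unique φ]
    rw [MvPolynomial.aeval_def, MvPolynomial.eval₂_eq_eval_map]
    simp [Function.comp_def]
  rw [hmul, ← h]
  rfl

end PureStates

/-! ### Trace forms at a point -/

section Evaluation

variable {n t : ℕ} {G : Set (MatPoly n t)}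

theorem evalMatPoly_mul (x : Fin n → ℝ) (p q : MatPoly n t) :
    evalMatPoly x (p * q) = evalMatPoly x p * evalMatPoly x q :=
  Matrix.map_mul

theorem evalMatPoly_transpose (x : Fin n → ℝ) (p : MatPoly n t) :
    evalMatPoly x p.transpose = (evalMatPoly x p).transpose := rfl

theorem evalMatPoly_map_C (x : Fin n → ℝ) (A : Matrix (Fin t) (Fin t) ℝ) :
    evalMatPoly x (A.map MvPolynomial.C) = A := by
  ext i j
  simp [evalMatPoly]

theorem evalMatPoly_one (x : Fin n → ℝ) : evalMatPoly x (1 : MatPoly n t) = 1 :=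
  Matrix.map_one _ (map_zero _) (map_one _)

/-- The linear form `p ↦ tr (p(x) ρ)` on symmetric matrix polynomials. -/
noncomputable def traceForm (x : Fin n → ℝ) (ρ : Matrix (Fin t) (Fin t) ℝ) :
    symMatPoly n t →ₗ[ℝ] ℝ where
  toFun p := (evalMatPoly x (p : MatPoly n t) * ρ).trace
  map_add' p q := by
    have : evalMatPoly x ((p + q : symMatPoly n t) : MatPoly n t) =
        evalMatPoly x (p : MatPoly n t) + evalMatPoly x (q : MatPoly n t) := by
      ext i j
      simp [evalMatPoly]
    rw [this, add_mul, Matrix.trace_add]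
  map_smul' c p := by
    have : evalMatPoly x ((c • p : symMatPoly n t) : MatPoly n t) =
        c • evalMatPoly x (p : MatPoly n t) := by
      ext i j
      simp [evalMatPoly]
    rw [this, smul_mul_assoc, Matrix.trace_smul, RingHom.id_apply]

theorem traceForm_apply (x : Fin n → ℝ) (ρ : Matrix (Fin t) (Fin t) ℝ) (p : symMatPoly n t) :
    traceForm x ρ p = (evalMatPoly x (p : MatPoly n t) * ρ).trace := rfl

theorem traceForm_sub (x : Fin n → ℝ) (ρ σ : Matrix (Fin t) (Fin t) ℝ) :
    (traceForm x (ρ - σ) : symMatPoly n t →ₗ[ℝ] ℝ) = traceForm x ρ - traceForm x σ :=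
  LinearMap.ext fun p => by
    rw [LinearMap.sub_apply, traceForm_apply, traceForm_apply, traceForm_apply, mul_sub,
      Matrix.trace_sub]

theorem traceForm_vecMulVec (x : Fin n → ℝ) (v : Fin t → ℝ) (p : symMatPoly n t) :
    traceForm x (Matrix.vecMulVec v v) p =
      v ⬝ᵥ Matrix.mulVec (evalMatPoly x (p : MatPoly n t)) v := by
  rw [traceForm_apply, Matrix.mul_vecMulVec, Matrix.trace_vecMulVec, dotProduct_comm]

/-- The symmetrised matrix unit `(Eᵢⱼ + Eⱼᵢ) / 2`. -/
noncomputable def symUnit (n : ℕ) {t : ℕ} (i j : Fin t) : symMatPoly n t :=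
  ⟨(1 / 2 : ℝ) • (Matrix.single i j 1 + Matrix.single j i 1), by
    change Matrix.transpose _ = _
    rw [Matrix.transpose_smul, Matrix.transpose_add, Matrix.transpose_single,
      Matrix.transpose_single, add_comm]⟩

theorem sum_smul_symUnit (p : symMatPoly n t) :
    p = ∑ i, ∑ j, (p : MatPoly n t) i j • symUnit n i j := by
  have hp : (p : MatPoly n t).transpose = p := p.2
  apply Subtype.ext
  simp only [AddSubmonoidClass.coe_finsetSum, coe_polySMul]
  have e : ∀ i j, (p : MatPoly n t) i j • ((symUnit n i j : symMatPoly n t) : MatPoly n t) =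
      (1 / 2 : ℝ) • Matrix.single i j ((p : MatPoly n t) i j) +
        (1 / 2 : ℝ) • Matrix.single j i ((p : MatPoly n t).transpose j i) := by
    intro i j
    change (p : MatPoly n t) i j • ((1 / 2 : ℝ) • (_ + _)) = _
    rw [smul_comm, smul_add, Matrix.smul_single, Matrix.smul_single, smul_add]
    simp
  simp only [e, Finset.sum_add_distrib, ← Finset.smul_sum]
  rw [Finset.sum_comm (f := fun i j => Matrix.single j i ((p : MatPoly n t).transpose j i)), hp,
    ← Matrix.matrix_eq_sum_single, ← add_smul]
  norm_num

/-- A linear form that is multiplicative over the centre at the point `x` depends only on `p(x)`;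
in coordinates it is a trace against a symmetric matrix. -/
theorem exists_eq_traceForm {L : symMatPoly n t →ₗ[ℝ] ℝ} {x : Fin n → ℝ}
    (hx : ∀ (f : MvPolynomial (Fin n) ℝ) (p : symMatPoly n t),
      L (f • p) = MvPolynomial.eval x f * L p) :
    ∃ ρ : Matrix (Fin t) (Fin t) ℝ, ρ.transpose = ρ ∧ L = traceForm x ρ := by
  have hs : ∀ i j, L (symUnit n i j) = L (symUnit n j i) := fun i j => by
    congr 1
    apply Subtype.ext
    change (1 / 2 : ℝ) • (_ + _) = (1 / 2 : ℝ) • (_ + _)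
    rw [add_comm]
  refine ⟨Matrix.of fun i j => L (symUnit n i j), ?_, ?_⟩
  · ext i j
    exact hs j i
  · ext p
    conv_lhs => rw [sum_smul_symUnit p]
    simp only [map_sum, hx, traceForm_apply, Matrix.trace, Matrix.diag, Matrix.mul_apply]
    refine Finset.sum_congr rfl fun i _ => Finset.sum_congr rfl fun j _ => ?_
    rw [Matrix.of_apply, hs j i]
    rfl

/-- Testing a positive trace form on the rank-one congruence of `g` by `w uᵀ` separates `g(x)`
from `ρ`. -/
theorem dotProduct_mul_dotProduct_nonneg (hG : G ⊆ (symMatPoly n t : Set (MatPoly n t)))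
    {x : Fin n → ℝ} {ρ : Matrix (Fin t) (Fin t) ℝ}
    (hρ : NonnegOn (quadraticModule G) (traceForm x ρ)) {g : MatPoly n t}
    (hg : g ∈ ({1} ∪ G : Set (MatPoly n t))) (u w : Fin t → ℝ) :
    0 ≤ (w ⬝ᵥ Matrix.mulVec (evalMatPoly x g) w) * (u ⬝ᵥ Matrix.mulVec ρ u) := by
  have hgs : g.transpose = g := by
    rcases hg with rfl | hg
    · exact Matrix.transpose_one
    · exact hG hg
  let q : MatPoly n t := (Matrix.vecMulVec w u).map MvPolynomial.C
  have hmem : q.transpose * g * q ∈ symMatPoly n t := by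
    change Matrix.transpose _ = _
    rw [Matrix.transpose_mul, Matrix.transpose_mul, Matrix.transpose_transpose, hgs,
      Matrix.mul_assoc]
  have h := hρ ⟨_, hmem⟩ (conj_mem_quadraticModule hg q)
  rw [traceForm_apply, evalMatPoly_mul, evalMatPoly_mul, evalMatPoly_transpose,
    evalMatPoly_map_C, Matrix.transpose_vecMulVec, Matrix.vecMulVec_mul,
    Matrix.vecMulVec_mul_vecMulVec, Matrix.vecMulVec_mul, Matrix.trace_vecMulVec,
    Matrix.smul_vecMul, dotProduct_smul, dotProduct_comm u, ← Matrix.dotProduct_mulVec,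
    ← Matrix.dotProduct_mulVec, smul_eq_mul] at h
  exact h

/-- A trace form at a point of the positivity set against a positive semidefinite matrix is
nonnegative on the quadratic module. -/
theorem nonnegOn_traceForm {x : Fin n → ℝ} (hx : x ∈ positivitySet G)
    {σ : Matrix (Fin t) (Fin t) ℝ} (hσ : σ.PosSemidef) :
    NonnegOn (quadraticModule G) (traceForm x σ) := by
  have hterm : ∀ g ∈ ({1} ∪ G : Set (MatPoly n t)), ∀ q : MatPoly n t,
      0 ≤ (evalMatPoly x (q.transpose * g * q) * σ).trace := by
    intro g hg q
    have hgx : (evalMatPoly x g).PosSemidef := by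
      rcases hg with rfl | hg
      · rw [evalMatPoly_one]
        exact Matrix.PosSemidef.one
      · exact hx g hg
    have h1 := hgx.conjTranspose_mul_mul_same (evalMatPoly x q)
    rw [Matrix.conjTranspose_eq_transpose_of_trivial, ← evalMatPoly_transpose,
      ← evalMatPoly_mul, ← evalMatPoly_mul] at h1
    obtain ⟨m, v, hv⟩ := Matrix.posSemidef_iff_eq_sum_vecMulVec.1 hσ
    rw [hv, Matrix.mul_sum, Matrix.trace_sum]
    refine Finset.sum_nonneg fun k _ => ?_
    rw [Matrix.mul_vecMulVec, Matrix.trace_vecMulVec, dotProduct_comm]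
    exact h1.dotProduct_mulVec_nonneg (v k)
  rintro ⟨f, hfs⟩ ⟨N, g, p, hg, hf⟩
  change f = _ at hf
  have : evalMatPoly x f = ∑ i, evalMatPoly x ((p i).transpose * g i * p i) := by
    rw [hf]
    ext i j
    simp only [evalMatPoly, Matrix.map_apply, Matrix.sum_apply, map_sum]
  rw [traceForm_apply]
  change 0 ≤ (evalMatPoly x f * σ).trace
  rw [this, Matrix.sum_mul, Matrix.trace_sum]
  exact Finset.sum_nonneg fun i _ => hterm (g i) (hg i) (p i)

end Evaluation

/-- Splitting off from a positive semidefinite matrix the rank-one part carried by its `i`-th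
column leaves a positive semidefinite matrix. -/
theorem posSemidef_sub_vecMulVec_col {m : Type*} [Fintype m] [DecidableEq m] {ρ : Matrix m m ℝ}
    (hρ : ρ.PosSemidef) {i : m} (hi : 0 < ρ i i) :
    (ρ - (ρ i i)⁻¹ • Matrix.vecMulVec (ρ.col i) (ρ.col i)).PosSemidef := by
  have hs : ρ.transpose = ρ := hρ.1
  refine Matrix.PosSemidef.of_dotProduct_mulVec_nonneg ?_ fun u => ?_
  · rw [Matrix.IsHermitian, Matrix.conjTranspose_eq_transpose_of_trivial, Matrix.transpose_sub,
      Matrix.transpose_smul, Matrix.transpose_vecMulVec, hs]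
  · have hcol : Matrix.mulVec ρ (Pi.single i 1) = ρ.col i := Matrix.mulVec_single_one ρ i
    have hq : ∀ r : ℝ, 0 ≤ ρ i i * (r * r) + 2 * (ρ.col i ⬝ᵥ u) * r + u ⬝ᵥ Matrix.mulVec ρ u := by
      intro r
      have h := hρ.dotProduct_mulVec_nonneg (r • Pi.single i 1 + u)
      have e1 : Pi.single i 1 ⬝ᵥ Matrix.mulVec ρ u = ρ.col i ⬝ᵥ u := by
        rw [Matrix.dotProduct_mulVec, ← Matrix.mulVec_transpose, hs, hcol]
      simp only [star_trivial, Matrix.mulVec_add, Matrix.mulVec_smul, dotProduct_add,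
        add_dotProduct, dotProduct_smul, smul_dotProduct, e1, hcol, smul_eq_mul,
        single_one_dotProduct, dotProduct_comm u (ρ.col i), Matrix.col_apply] at h
      linarith
    have hd := discrim_le_zero hq
    rw [discrim] at hd
    have h2 : (ρ i i)⁻¹ * (ρ.col i ⬝ᵥ u) ^ 2 ≤ u ⬝ᵥ Matrix.mulVec ρ u := by
      rw [inv_mul_le_iff₀ hi]
      linarith
    rw [star_trivial, Matrix.sub_mulVec, dotProduct_sub, Matrix.smul_mulVec,
      Matrix.vecMulVec_mulVec, dotProduct_smul]
    simp only [op_smul_eq_smul, dotProduct_smul, smul_eq_mul, dotProduct_comm u (ρ.col i)]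
    linarith

/-! ### Pure states are vector states -/

theorem theorem9 (n t : ℕ) (G : Set (MatPoly n t))
    (hG : G ⊆ (symMatPoly n t : Set (MatPoly n t)))
    (hM : IsArchimedeanModule (quadraticModule G))
    (L : symMatPoly n t →ₗ[ℝ] ℝ) (hL : IsPureState (quadraticModule G) L) :
    ∃ x ∈ positivitySet G, ∃ v : EuclideanSpace ℝ (Fin t), ‖v‖ = 1 ∧
      ∀ p : symMatPoly n t,
        L p = inner ℝ (Matrix.toEuclideanLin (evalMatPoly x (p : MatPoly n t)) v) v := by
  obtain ⟨x, hx⟩ := hL.exists_point hM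
  obtain ⟨ρ, hρs, hLρ⟩ := exists_eq_traceForm hx
  have hpos : NonnegOn (quadraticModule G) (traceForm x ρ) := hLρ ▸ hL.1.1
  have htr : ρ.trace = 1 := by
    have h : L (symOne n t) = 1 := hL.1.2
    rw [hLρ, traceForm_apply] at h
    change (evalMatPoly x 1 * ρ).trace = 1 at h
    rwa [evalMatPoly_one, one_mul] at h
  obtain ⟨i, hi⟩ : ∃ i, 0 < ρ i i := by
    by_contra! h
    have : ρ.trace ≤ 0 := Finset.sum_nonpos fun i _ => h i
    linarith
  have hunit : ∀ A : Matrix (Fin t) (Fin t) ℝ,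
      (Pi.single i 1 : Fin t → ℝ) ⬝ᵥ Matrix.mulVec A (Pi.single i 1) = A i i := fun A => by simp
  have hρ : ρ.PosSemidef := by
    refine Matrix.PosSemidef.of_dotProduct_mulVec_nonneg hρs fun u => ?_
    have h := dotProduct_mul_dotProduct_nonneg hG hpos (Or.inl rfl) u (Pi.single i 1)
    rwa [hunit, evalMatPoly_one, Matrix.one_apply_eq, one_mul] at h
  have hxS : x ∈ positivitySet G := by
    intro g hg
    refine Matrix.PosSemidef.of_dotProduct_mulVec_nonneg ?_ fun w => ?_
    · have h : g.transpose = g := hG hg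
      change (evalMatPoly x g).transpose = _
      rw [← evalMatPoly_transpose, h]
    · have h := dotProduct_mul_dotProduct_nonneg hG hpos (Or.inr hg) (Pi.single i 1) w
      rw [hunit] at h
      exact nonneg_of_mul_nonneg_left h hi
  -- the part of `L` carried by the `i`-th column of `ρ` is dominated by `L`
  set w : Fin t → ℝ := ρ.col i with hw
  have hR : ((ρ i i)⁻¹ • Matrix.vecMulVec w w).PosSemidef :=
    (by simpa using Matrix.posSemidef_vecMulVec_self_star w :
      (Matrix.vecMulVec w w).PosSemidef).smul (inv_nonneg.2 hi.le)
  have hK := hL.eq_smul_of_le hM (nonnegOn_traceForm hxS hR) (by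
    rw [hLρ, ← traceForm_sub]
    exact nonnegOn_traceForm hxS (posSemidef_sub_vecMulVec_col hρ hi))
  have hval : ∀ p : symMatPoly n t, traceForm x ((ρ i i)⁻¹ • Matrix.vecMulVec w w) p =
      (ρ i i)⁻¹ * (w ⬝ᵥ Matrix.mulVec (evalMatPoly x (p : MatPoly n t)) w) := fun p => by
    rw [← traceForm_vecMulVec, traceForm_apply, traceForm_apply, mul_smul_comm,
      Matrix.trace_smul, smul_eq_mul]
  have hLw : ∀ p : symMatPoly n t, w ⬝ᵥ Matrix.mulVec (evalMatPoly x (p : MatPoly n t)) w =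
      (w ⬝ᵥ w) * L p := by
    intro p
    have h := LinearMap.congr_fun hK p
    rw [LinearMap.smul_apply, hval, hval, symOne, evalMatPoly_one, Matrix.one_mulVec, smul_eq_mul,
      mul_assoc] at h
    exact mul_left_cancel₀ (inv_ne_zero hi.ne') h
  set W : EuclideanSpace ℝ (Fin t) := WithLp.toLp 2 w with hW
  have hnorm : ‖W‖ ^ 2 = w ⬝ᵥ w := by
    rw [EuclideanSpace.real_norm_sq_eq]
    simp [dotProduct, hW, sq]
  have hW0 : ‖W‖ ≠ 0 := by
    have : W ≠ 0 := fun h => by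
      have h1 : W i = 0 := by rw [h]; rfl
      exact hi.ne' h1
    exact norm_ne_zero_iff.2 this
  refine ⟨x, hxS, ‖W‖⁻¹ • W, ?_, fun p => ?_⟩
  · rw [norm_smul, norm_inv, norm_norm, inv_mul_cancel₀ hW0]
  · have hin : inner ℝ (Matrix.toEuclideanLin (evalMatPoly x (p : MatPoly n t)) W) W =
        w ⬝ᵥ Matrix.mulVec (evalMatPoly x (p : MatPoly n t)) w := by
      rw [EuclideanSpace.inner_eq_star_dotProduct]
      simp [hW]
    rw [map_smul, real_inner_smul_left, real_inner_smul_right, hin, hLw, ← hnorm]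
    field_simp
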